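/- A word is a finite sequence over $\{0,1\}$. For a prime $m$ let $L^0(m)=\{w0 : w\in\{0,1\}^*,\ |w0|=km \text{ for some integer } k\ge 1\}$. An MO-1QFA over $\{0,1\}$ consists of a finite set $Q$ (an orthonormal basis of $\mathcal H(Q)=\mathbb C^{Q}$), a unit vector $|\psi_0\rangle\in\mathcal H(Q)$, unitary operators $U(\sigma)$ on $\mathcal H(Q)$ for $\sigma\in\{0,1\}$, and a set $Q_{acc}\subseteq Q$; its accepting probability on $x=\sigma_1\cdots\sigma_n$ is $p_a(x)=\|P_aU(\sigma_n)\cdots U(\sigma_1)|\psi_0\rangle\|^2$ with $P_a=\sum_{q\in Q_{acc}}|q\rangle\langle q|$. An MM-1QFA has in addition a unitary operator $U(\$)$ for a right end-mark $\$$ and a set $Q_{rej}\subseteq Q$ disjoint from $Q_{acc}$; with $\sigma_{n+1}=\$$ and $P_n=\sum_{q\in Q\setminus(Q_{acc}\cup Q_{rej})}|q\rangle\langle q|$ its accepting probability is $$p_a(x)=\sum_{k=1}^{n+1}\big\|P_aU(\sigma_k)\,P_nU(\sigma_{k-1})\cdots P_nU(\sigma_1)|\psi_0\rangle\big\|^2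 .$$ Such an automaton accepts a language $L$ (with bounded error) if there are $\lambda\in(0,1]$ and $\epsilon>0$ with $p_a(x)\ge\lambda+\epsilon$ for all $x\in L$ and $p_a(x)\le\lambda-\epsilon$ for all $x\notin L$. A 1QFAC acceptor over $\{0,1\}$ consists of finite sets $S$ (classical states) and $Q$ (quantum basis states), $s_0\in S$, a unit vector $|\psi_0\rangle\in\mathcal H(Q)$, a map $\delta:S\times\{0,1\}\to S$, unitary operators $U_{s\sigma}$ on $\mathcal H(Q)$, and for each $s\in S$ a projective measurement $\{P_{s,a},P_{s,r}\}$ on $\mathcal H(Q)$ (orthogonal projections with $P_{s,a}+P_{s,r}=I$ and $P_{s,a}P_{s,r}=0$). It starts in $(s_0,|\psi_0\rangle)$; reading $\sigma$ changes $(s,|\psi\rangle)$ into $(\delta(s,\sigma),U_{s\sigma}|\psi\rangle)$; if it is in $(s,|\psi\rangle)$ after reading $x$, it accepts $x$ with probability $\|P_{s,a}|\psi\rangle\|^2$. Theorem. For every prime $m$ the language $L^0(m)$ is regular and satisfies the following. (1) No MO-1QFA and no MM-1QFA accepts $L^0(m)$ with bounded error. (2) The minimal DFA accepting $L^0(m)$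 has exactly $m+1$ states; that is, $m+1$ is the least number of states of a (complete) DFA accepting $L^0(m)$. (3) For every $\varepsilon>0$ there is a constant $C>0$, depending only on $\varepsilon$, such that for every prime $m$ there is a 1QFAC acceptor with $2$ classical states and at most $C\log m$ quantum basis states that accepts every $x\in L^0(m)$ with probability $1$ and every $x\notin L^0(m)$ with probability smaller than $\varepsilon$. -/

import Mathlib

namespace QFA

/-- The Hilbert space `H(B)` freely generated by a finite set `B`: `B` indexes an orthonormal
basis. -/
abbrev Hilb (B : Type*) := EuclideanSpace ℂ B

/-- Unitary operators on `H(B)`. -/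
abbrev UnitaryOp (B : Type*) [Fintype B] := Hilb B ≃ₗᵢ[ℂ] Hilb B

/-- The projection `∑_{q ∈ F} |q⟩⟨q|` onto the span of the basis vectors `|q⟩`, `q ∈ F`. -/
noncomputable def basisProj {Q : Type*} [Fintype Q] (F : Finset Q) : Hilb Q →L[ℂ] Hilb Q :=
  ∑ q ∈ F, InnerProductSpace.rankOne ℂ (EuclideanSpace.basisFun Q ℂ q)
    (EuclideanSpace.basisFun Q ℂ q)

/-- A word function `p` (the accepting probability of some machine) accepts the language `L` with
bounded error: there is a cut-point `lam ∈ (0, 1]` isolated by some `ε > 0`. -/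
def AcceptsBounded {α : Type*} (p : List α → ℝ) (L : Language α) : Prop :=
  ∃ lam ε : ℝ, 0 < lam ∧ lam ≤ 1 ∧ 0 < ε ∧
    (∀ x, x ∈ L → lam + ε ≤ p x) ∧ (∀ x, x ∉ L → p x ≤ lam - ε)

/-- Measure-once one-way quantum finite automata with input alphabet `α` and set of basis
states `Q`. -/
structure MO1QFA (α Q : Type*) [Fintype Q] where
  init : Hilb Q
  norm_init : ‖init‖ = 1
  U : α → UnitaryOp Q
  acc : Finset Q

/-- The state `U(σₘ) ⋯ U(σ₁) |ψ₀⟩` after reading `x = σ₁ ⋯ σₘ`. -/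
noncomputable def MO1QFA.state {α Q : Type*} [Fintype Q] (A : MO1QFA α Q) (x : List α) : Hilb Q :=
  x.foldl (fun ψ σ => A.U σ ψ) A.init

/-- The accepting probability of a measure-once automaton. -/
noncomputable def MO1QFA.accProb {α Q : Type*} [Fintype Q] (A : MO1QFA α Q) (x : List α) : ℝ :=
  ‖basisProj A.acc (A.state x)‖ ^ 2

/-- Measure-many one-way quantum finite automata. The symbols on the tape are `some σ` for an
input letter `σ`, and `none` for the right end-mark `$`. -/
structure MM1QFA (α Q : Type*) [Fintype Q] where
  init : Hilb Q
  norm_init : ‖init‖ = 1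
  U : Option α → UnitaryOp Q
  acc : Finset Q
  rej : Finset Q
  disj : Disjoint acc rej

/-- The non-halting basis states. -/
def MM1QFA.non {α Q : Type*} [Fintype Q] [DecidableEq Q] (A : MM1QFA α Q) : Finset Q :=
  Finset.univ \ (A.acc ∪ A.rej)

/-- The tape content `σ₁ ⋯ σₘ $` on input `x = σ₁ ⋯ σₘ`. -/
def tape {α : Type*} (x : List α) : List (Option α) := x.map some ++ [none]

/-- The unnormalized non-halted state `P_n U(τₖ) ⋯ P_n U(τ₁) |ψ₀⟩` after `τ₁ ⋯ τₖ`. -/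
noncomputable def MM1QFA.state {α Q : Type*} [Fintype Q] [DecidableEq Q] (A : MM1QFA α Q)
    (t : List (Option α)) : Hilb Q :=
  t.foldl (fun ψ τ => basisProj A.non (A.U τ ψ)) A.init

/-- The accepting probability of a measure-many automaton: the sum over all positions `k` of the
tape (counted from `0`) of the probability of being observed in an accepting state just after the
symbol at position `k` has been read. -/
noncomputable def MM1QFA.accProb {α Q : Type*} [Fintype Q] [DecidableEq Q] (A : MM1QFA α Q)
    (x : List α) : ℝ :=
  ∑ k : Fin (tape x).length,
    ‖basisProj A.acc (A.U ((tape x).get k) (A.state ((tape x).take k)))‖ ^ 2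

/-- Projective measurements on `H(Q)` with outcomes in `Γ`. -/
structure ProjMeasurement (Γ Q : Type*) [Fintype Γ] [Fintype Q] where
  proj : Γ → (Hilb Q →L[ℂ] Hilb Q)
  isStarProjection : ∀ γ, IsStarProjection (proj γ)
  orthogonal : ∀ γ γ', γ ≠ γ' → proj γ * proj γ' = 0
  sum_eq_one : ∑ γ, proj γ = 1

/-- One-way quantum finite automata together with classical states (1QFAC): input alphabet `α`,
output alphabet `Γ`, set of classical states `S`, quantum state basis `Q`. -/
structure QFAC (α Γ S Q : Type*) [Fintype Γ] [Fintype Q] where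
  start : S
  init : Hilb Q
  norm_init : ‖init‖ = 1
  δ : S → α → S
  U : S → α → UnitaryOp Q
  meas : S → ProjMeasurement Γ Q

/-- The pair of the classical state and the quantum state after reading `x`. On reading `σ` in
classical state `s`, the operator `U s σ` is applied and the classical state becomes `δ s σ`. -/
noncomputable def QFAC.config {α Γ S Q : Type*} [Fintype Γ] [Fintype Q] (A : QFAC α Γ S Q)
    (x : List α) : S × Hilb Q :=
  x.foldl (fun c σ => (A.δ c.1 σ, A.U c.1 σ c.2)) (A.start, A.init)

/-- The probability of producing the outcome `γ` on input `x`. -/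
noncomputable def QFAC.prob {α Γ S Q : Type*} [Fintype Γ] [Fintype Q] (A : QFAC α Γ S Q)
    (γ : Γ) (x : List α) : ℝ :=
  ‖(A.meas (A.config x).1).proj γ (A.config x).2‖ ^ 2

/-- A 1QFAC acceptor has the two outcomes `true` (accept) and `false` (reject). -/
noncomputable def QFAC.accProb {α S Q : Type*} [Fintype Q] (A : QFAC α Bool S Q)
    (x : List α) : ℝ :=
  A.prob true x

/-- The possible numbers of states of a (complete) DFA that accepts `L`. -/
def dfaSizes {α : Type*} (L : Language α) : Set ℕ :=
  {n | ∃ (σ : Type) (_ : Fintype σ) (M : DFA α σ), M.accepts = L ∧ Fintype.card σ = n}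

/-- The language `L⁰(m)` of all binary words `w0` with `|w0| = km` for some `k = 1, 2, 3, …`. -/
def L0 (m : ℕ) : Language (Fin 2) :=
  {x | ∃ w : List (Fin 2), x = w ++ [0] ∧ ∃ k : ℕ, 1 ≤ k ∧ x.length = k * m}

end QFA

/-!
The measure-once part is Poincaré recurrence: some positive power of a unitary operator of a
finite-dimensional space is arbitrarily close to the identity (`exists_iterate_near_id`), so that
appending a suitable `1ᵏ` to a word of the language leaves its accepting probability almost
unchanged, although the new word is outside the language.

For measure-many automata the norm of the non-halted part only decreases along a word. After a
word of the language at which this norm is almost minimal, reading `1ᵏ` can halt the automaton only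
with tiny probability, because every word extends to a word of the language. Hence the
measurements hardly disturb the unitary evolution
(`MM1QFA.norm_state_append_replicate_sub_le`), and the recurrence argument applies again. What was
accepted before stays accepted, so only the measurement at the end-mark has to be compared.

The minimal automaton stores the length modulo `m`, and at residue `0` whether the word is in the
language. The words `0ⁱ`, `i ≤ m`, are pairwise inequivalent.

The small acceptor remembers classically whether the last letter is `0`, and quantumly only the
length: its unitary is diagonal with entries `exp (2πi aₗ / m)`, started in the uniform
superposition and measured against it. A word of length `n` ending in `0` is accepted with
probability `|(1/d) ∑ₗ exp (2πi aₗ n / m)|²`, which is `1` if `m ∣ n`. Chernoff's method gives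
`d = O(log m)` frequencies `aₗ` for which this is small for all other `n`
(`exists_sample_sum_lt`, `exists_frequencies`).
-/

namespace QFA

/-! ### The language and its minimal automaton -/

theorem mem_L0_iff {m : ℕ} {x : List (Fin 2)} :
    x ∈ L0 m ↔ (∃ w, x = w ++ [0]) ∧ m ∣ x.length := by
  constructor
  · rintro ⟨w, hw, k, -, hk⟩
    exact ⟨⟨w, hw⟩, k, by rw [hk, mul_comm]⟩
  · rintro ⟨⟨w, hw⟩, k, hk⟩
    refine ⟨w, hw, k, Nat.one_le_iff_ne_zero.2 ?_, by rw [hk, mul_comm]⟩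
    rintro rfl
    simp [hw] at hk

theorem append_singleton_mem_L0_iff {m : ℕ} {x : List (Fin 2)} {σ : Fin 2} :
    x ++ [σ] ∈ L0 m ↔ σ = 0 ∧ m ∣ x.length + 1 := by
  simp [mem_L0_iff]

theorem nil_notMem_L0 {m : ℕ} : [] ∉ L0 m := by
  simp [mem_L0_iff]

theorem replicate_zero_mem_L0_iff {m n : ℕ} :
    List.replicate n 0 ∈ L0 m ↔ n ≠ 0 ∧ m ∣ n := by
  cases n with
  | zero => simp [nil_notMem_L0]
  | succ n => simp [List.replicate_succ', append_singleton_mem_L0_iff]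

theorem append_ones_notMem_L0 {m k : ℕ} (hk : k ≠ 0) (x : List (Fin 2)) :
    x ++ List.replicate k 1 ∉ L0 m := by
  obtain ⟨k, rfl⟩ := Nat.exists_eq_succ_of_ne_zero hk
  rw [List.replicate_succ', ← List.append_assoc, append_singleton_mem_L0_iff]
  simp

/-- Every word is a prefix of a word of `L⁰(m)`. -/
theorem exists_append_mem_L0 {m : ℕ} (hm : 0 < m) (x : List (Fin 2)) :
    ∃ u, x ++ u ∈ L0 m := by
  have hlt : x.length < m * (x.length + 1) := by nlinarith
  refine ⟨List.replicate (m * (x.length + 1) - x.length - 1) 0 ++ [0], ?_⟩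
  rw [← List.append_assoc, append_singleton_mem_L0_iff]
  refine ⟨rfl, x.length + 1, ?_⟩
  simp only [List.length_append, List.length_replicate]
  omega

/-- The automaton with states `0, …, m` whose state after a word `x` is `m` if `x ∈ L⁰(m)`, and
the residue of the length of `x` modulo `m` otherwise. -/
def residueDFA (m : ℕ) : DFA (Fin 2) (Fin (m + 1)) where
  step s σ :=
    if m ∣ s + 1 then (if σ = 0 then Fin.last m else 0) else Fin.ofNat (m + 1) ((s + 1) % m)
  start := 0
  accept := {Fin.last m}

theorem residueDFA_eval {m : ℕ} (hm : 2 ≤ m) (x : List (Fin 2)) :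
    ((x ∈ L0 m → (residueDFA m).eval x = Fin.last m) ∧
      (x ∉ L0 m → ((residueDFA m).eval x : ℕ) = x.length % m)) := by
  induction x using List.reverseRecOn with
  | nil => simp [nil_notMem_L0, residueDFA]
  | append_singleton x σ ih =>
    have hs : ((residueDFA m).eval x : ℕ) ≡ x.length [MOD m] := by
      by_cases hx : x ∈ L0 m
      · rw [ih.1 hx, Fin.val_last]
        exact ((mem_L0_iff.1 hx).2.modEq_zero_nat.trans
          (dvd_refl m).modEq_zero_nat.symm).symm
      · rw [ih.2 hx]
        exact Nat.mod_modEq _ _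
    have hs1 : (residueDFA m).eval x + 1 ≡ x.length + 1 [MOD m] := hs.add_right 1
    have hd : m ∣ (residueDFA m).eval x + 1 ↔ m ∣ x.length + 1 := hs1.dvd_iff dvd_rfl
    rw [DFA.eval_append_singleton, append_singleton_mem_L0_iff]
    generalize (residueDFA m).eval x = s at *
    by_cases h : m ∣ x.length + 1
    · have h0 : (x.length + 1) % m = 0 := Nat.mod_eq_zero_of_dvd h
      by_cases hσ : σ = 0 <;> simp [residueDFA, hd, h, hσ, h0]
    · have hlt : (s + 1 : ℕ) % m < m + 1 := (Nat.mod_lt _ (by omega)).trans (by omega)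
      simp [residueDFA, hd, h, Nat.mod_eq_of_lt hlt]
      exact hs1

theorem residueDFA_accepts {m : ℕ} (hm : 2 ≤ m) : (residueDFA m).accepts = L0 m := by
  ext x
  rw [DFA.mem_accepts]
  by_cases hx : x ∈ L0 m
  · exact iff_of_true ((residueDFA_eval hm x).1 hx) hx
  · have h := (residueDFA_eval hm x).2 hx
    have hlt : x.length % m < m := Nat.mod_lt _ (by omega)
    refine iff_of_false (fun hacc => ?_) hx
    rw [Set.mem_singleton_iff.1 hacc, Fin.val_last] at h
    omega

/-- The words `0ⁱ` with `i ≤ m` lead to pairwise different states, since `0ᵐ⁻ʲ` separates `0ⁱ`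
from `0ʲ` when `i < j`. -/
theorem le_card_of_accepts_eq_L0 {m : ℕ} (hm : 0 < m) {σ : Type*} [Fintype σ]
    (M : DFA (Fin 2) σ) (hM : M.accepts = L0 m) : m + 1 ≤ Fintype.card σ := by
  have key : ∀ i j : Fin (m + 1), i < j →
      M.eval (List.replicate i 0) ≠ M.eval (List.replicate j 0) := by
    intro i j hij he
    have hsplit : ∀ a b : ℕ, M.eval (List.replicate (a + b) 0) =
        M.evalFrom (M.eval (List.replicate a 0)) (List.replicate b 0) := fun a b => by
      rw [List.replicate_add, DFA.eval, DFA.evalFrom_of_append]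
    have hij' : (i : ℕ) < j := hij
    have hj := j.is_le
    have h1 : List.replicate (j + (m - j)) 0 ∈ L0 m :=
      replicate_zero_mem_L0_iff.2 (by rw [Nat.add_sub_cancel' hj]; exact ⟨hm.ne', dvd_rfl⟩)
    have h2 : List.replicate (i + (m - j)) 0 ∉ L0 m := by
      rw [replicate_zero_mem_L0_iff]
      rintro ⟨h0, hdvd⟩
      exact h0 (Nat.eq_zero_of_dvd_of_lt hdvd (by omega))
    rw [← hM, DFA.mem_accepts, hsplit] at h1 h2
    rw [he] at h2
    exact h2 h1
  have hinj : Function.Injective fun i : Fin (m + 1) => M.eval (List.replicate i 0) := by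
    intro i j h
    rcases lt_trichotomy i j with hij | hij | hij
    · exact absurd h (key i j hij)
    · exact hij
    · exact absurd h.symm (key j i hij)
  simpa using Fintype.card_le_of_injective _ hinj

theorem isLeast_dfaSizes_L0 {m : ℕ} (hm : 2 ≤ m) : IsLeast (dfaSizes (L0 m)) (m + 1) := by
  refine ⟨⟨Fin (m + 1), inferInstance, residueDFA m, residueDFA_accepts hm, by simp⟩, ?_⟩
  rintro n ⟨σ, _, M, hM, rfl⟩
  exact le_card_of_accepts_eq_L0 (by omega) M hM

/-! ### Projections onto basis vectors and recurrence of isometries -/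

theorem basisProj_apply {Q : Type*} [Fintype Q] [DecidableEq Q] (F : Finset Q) (ψ : Hilb Q)
    (q : Q) : basisProj F ψ q = if q ∈ F then ψ q else 0 := by
  simp [basisProj, EuclideanSpace.inner_single_left, Pi.single_apply]

/-- Pythagoras for the projection onto the span of a set of basis vectors. -/
theorem norm_sq_basisProj_add {Q : Type*} [Fintype Q] (F : Finset Q) (ψ : Hilb Q) :
    ‖basisProj F ψ‖ ^ 2 + ‖basisProj F ψ - ψ‖ ^ 2 = ‖ψ‖ ^ 2 := by
  classical
  simp only [EuclideanSpace.norm_sq_eq, ← Finset.sum_add_distrib]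
  refine Finset.sum_congr rfl fun q _ => ?_
  by_cases hq : q ∈ F <;> simp [basisProj_apply, hq]

theorem norm_basisProj_le {Q : Type*} [Fintype Q] (F : Finset Q) (ψ : Hilb Q) :
    ‖basisProj F ψ‖ ≤ ‖ψ‖ := by
  have h := norm_sq_basisProj_add F ψ
  exact le_of_sq_le_sq (by nlinarith [sq_nonneg ‖basisProj F ψ - ψ‖]) (norm_nonneg _)

/-- On the unit ball, the measured probability `‖P φ‖²` is `2`-Lipschitz in the state `φ`. -/
theorem norm_sq_basisProj_sub_le {Q : Type*} [Fintype Q] (F : Finset Q) {φ χ : Hilb Q}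
    (hφ : ‖φ‖ ≤ 1) (hχ : ‖χ‖ ≤ 1) :
    ‖basisProj F φ‖ ^ 2 - ‖basisProj F χ‖ ^ 2 ≤ 2 * ‖χ - φ‖ := by
  have h1 := (norm_basisProj_le F φ).trans hφ
  have h2 := (norm_basisProj_le F χ).trans hχ
  have h3 : ‖basisProj F φ‖ - ‖basisProj F χ‖ ≤ ‖χ - φ‖ := by
    refine (norm_sub_norm_le _ _).trans ?_
    rw [← map_sub, norm_sub_rev χ]
    exact norm_basisProj_le F _
  nlinarith [norm_nonneg (χ - φ), norm_nonneg (basisProj F φ), norm_nonneg (basisProj F χ)]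

/-- Some positive power of a unitary operator of a finite-dimensional space is close to the
identity in operator norm: the powers lie in a compact ball. -/
theorem exists_iterate_near_id {E : Type*} [NormedAddCommGroup E] [NormedSpace ℂ E]
    [FiniteDimensional ℂ E] (U : E ≃ₗᵢ[ℂ] E) {δ : ℝ} (hδ : 0 < δ) :
    ∃ k : ℕ, k ≠ 0 ∧ ∀ ψ : E, ‖U^[k] ψ - ψ‖ ≤ δ * ‖ψ‖ := by
  have hprop : ProperSpace (E →L[ℂ] E) := FiniteDimensional.proper ℂ _
  let f : ℕ → (E →L[ℂ] E) := fun n => ((U ^ n).toLinearIsometry.toContinuousLinearMap)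
  have hf : ∀ n ψ, f n ψ = U^[n] ψ := fun n ψ => by
    have : ∀ n, ((U ^ n : E ≃ₗᵢ[ℂ] E) : E → E) = U^[n] := fun n => by
      induction n with
      | zero => rfl
      | succ n ih => rw [pow_succ, LinearIsometryEquiv.coe_mul, ih, Function.iterate_succ]
    exact congrFun (this n) ψ
  have hball : ∀ n, f n ∈ Metric.closedBall (0 : E →L[ℂ] E) 1 := fun n => by
    rw [mem_closedBall_zero_iff]
    exact LinearIsometry.norm_toContinuousLinearMap_le _
  obtain ⟨g, -, φ, hφ, hg⟩ := tendsto_subseq_of_bounded Metric.isBounded_closedBall hball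
  obtain ⟨N, hN⟩ := Metric.cauchySeq_iff.1 hg.cauchySeq δ hδ
  have hlt : φ N < φ (N + 1) := hφ (Nat.lt_succ_self N)
  refine ⟨φ (N + 1) - φ N, by omega, fun ψ => ?_⟩
  have hdist := (hN (N + 1) (by omega) N le_rfl).le
  rw [dist_eq_norm] at hdist
  -- `Uⁱ` is an isometry, so that `‖Uʲ⁻ⁱ ψ - ψ‖ = ‖Uʲ ψ - Uⁱ ψ‖`.
  have hiso : ∀ n (a b : E), ‖U^[n] a - U^[n] b‖ = ‖a - b‖ := fun n a b => by
    induction n with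
    | zero => rfl
    | succ n ih =>
      rw [Function.iterate_succ_apply', Function.iterate_succ_apply', ← map_sub,
        LinearIsometryEquiv.norm_map, ih]
  rw [← hiso (φ N), ← Function.iterate_add_apply, Nat.add_sub_cancel' hlt.le, ← hf, ← hf,
    ← sub_apply]
  exact ContinuousLinearMap.le_of_opNorm_le _ hdist ψ

/-! ### Measure-once automata -/

theorem foldl_replicate {α β : Type*} (f : β → α → β) (b : β) (a : α) (k : ℕ) :
    (List.replicate k a).foldl f b = (fun b => f b a)^[k] b := by
  induction k generalizing b with
  | zero => rfl
  | succ k ih => rw [List.replicate_succ, List.foldl_cons, ih, Function.iterate_succ_apply]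

theorem MO1QFA.norm_state {α Q : Type*} [Fintype Q] (A : MO1QFA α Q) (x : List α) :
    ‖A.state x‖ = 1 := by
  induction x using List.reverseRecOn with
  | nil => exact A.norm_init
  | append_singleton x σ ih =>
    rw [← ih]
    simp [MO1QFA.state]

/-- Appending a suitable power of `1` to a word changes its accepting probability arbitrarily
little, but throws it out of the language. -/
theorem MO1QFA.not_acceptsBounded_L0 {m : ℕ} (hm : 0 < m) {Q : Type*} [Fintype Q]
    (A : MO1QFA (Fin 2) Q) : ¬ AcceptsBounded A.accProb (L0 m) := by
  rintro ⟨lam, ε, -, -, hε, hacc, hrej⟩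
  obtain ⟨k, hk, hU⟩ := exists_iterate_near_id (A.U 1) (half_pos hε)
  obtain ⟨x, hx⟩ := exists_append_mem_L0 hm []
  rw [List.nil_append] at hx
  have hy := hrej _ (append_ones_notMem_L0 (m := m) hk x)
  have hstate : A.state (x ++ List.replicate k 1) = (A.U 1)^[k] (A.state x) := by
    rw [MO1QFA.state, List.foldl_append, foldl_replicate]
    rfl
  have hdiff := norm_sq_basisProj_sub_le A.acc (A.norm_state x).le
    (A.norm_state (x ++ List.replicate k 1)).le
  have hnear := hU (A.state x)
  rw [A.norm_state, ← hstate] at hnear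
  have hx' := hacc x hx
  simp only [MO1QFA.accProb] at hx' hy
  linarith

/-! ### Measure-many automata -/

namespace MM1QFA

variable {α Q : Type*} [Fintype Q] [DecidableEq Q]

/-- The probability of halting in an accepting state while the tape segment `t` is read, started
in the unnormalized state `ψ`. -/
noncomputable def accOn (A : MM1QFA α Q) : List (Option α) → Hilb Q → ℝ
  | [], _ => 0
  | τ :: t, ψ => ‖basisProj A.acc (A.U τ ψ)‖ ^ 2 + accOn A t (basisProj A.non (A.U τ ψ))

theorem accOn_nonneg (A : MM1QFA α Q) (t : List (Option α)) (ψ : Hilb Q) : 0 ≤ A.accOn t ψ := by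
  induction t generalizing ψ with
  | nil => exact le_rfl
  | cons τ t ih => exact add_nonneg (sq_nonneg _) (ih _)

theorem accOn_append (A : MM1QFA α Q) (s t : List (Option α)) (ψ : Hilb Q) :
    A.accOn (s ++ t) ψ =
      A.accOn s ψ + A.accOn t (s.foldl (fun ψ τ => basisProj A.non (A.U τ ψ)) ψ) := by
  induction s generalizing ψ with
  | nil => simp [accOn]
  | cons τ s ih => simp [accOn, ih, add_assoc]

theorem sum_eq_accOn (A : MM1QFA α Q) (t : List (Option α)) (ψ : Hilb Q) :
    ∑ k : Fin t.length, ‖basisProj A.acc (A.U (t.get k)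
      ((t.take k).foldl (fun ψ τ => basisProj A.non (A.U τ ψ)) ψ))‖ ^ 2 = A.accOn t ψ := by
  induction t generalizing ψ with
  | nil => rfl
  | cons τ t ih =>
    rw [accOn, ← ih]
    exact Fin.sum_univ_succ (n := t.length) _

theorem accProb_eq (A : MM1QFA α Q) (x : List α) :
    A.accProb x = A.accOn (x.map some) A.init +
      ‖basisProj A.acc (A.U none (A.state (x.map some)))‖ ^ 2 := by
  have h : A.accProb x = A.accOn (tape x) A.init := sum_eq_accOn A (tape x) A.init
  rw [h, tape, accOn_append]
  simp [accOn, MM1QFA.state]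

theorem state_append (A : MM1QFA α Q) (s t : List (Option α)) :
    A.state (s ++ t) = t.foldl (fun ψ τ => basisProj A.non (A.U τ ψ)) (A.state s) :=
  List.foldl_append

theorem norm_state_append_le (A : MM1QFA α Q) (s t : List (Option α)) :
    ‖A.state (s ++ t)‖ ≤ ‖A.state s‖ := by
  induction t using List.reverseRecOn with
  | nil => simp
  | append_singleton t τ ih =>
    rw [← List.append_assoc, state_append]
    refine (norm_basisProj_le _ _).trans ?_
    rwa [LinearIsometryEquiv.norm_map]

theorem norm_state_le_one (A : MM1QFA α Q) (t : List (Option α)) : ‖A.state t‖ ≤ 1 :=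
  (A.norm_state_append_le [] t).trans A.norm_init.le

/-- While a block of equal symbols is read, the measurements move the state away from the unitary
orbit by at most `s` per step if at most `s²` of the squared norm is lost in the whole block. -/
theorem norm_state_append_replicate_sub_le (A : MM1QFA α Q) (t : List (Option α)) (τ : Option α)
    (k : ℕ) {s : ℝ} (hs : 0 ≤ s)
    (h : ‖A.state t‖ ^ 2 ≤ ‖A.state (t ++ List.replicate k τ)‖ ^ 2 + s ^ 2) :
    ‖A.state (t ++ List.replicate k τ) - (A.U τ)^[k] (A.state t)‖ ≤ k * s := by
  induction k with
  | zero => simp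
  | succ k ih =>
    have hsucc : A.state (t ++ List.replicate (k + 1) τ) =
        basisProj A.non (A.U τ (A.state (t ++ List.replicate k τ))) := by
      rw [List.replicate_succ', ← List.append_assoc, state_append]
      rfl
    have hle : ‖A.state (t ++ List.replicate k τ)‖ ^ 2 ≤ ‖A.state t‖ ^ 2 := by
      gcongr
      exact A.norm_state_append_le t _
    have hpyth := norm_sq_basisProj_add A.non (A.U τ (A.state (t ++ List.replicate k τ)))
    rw [← hsucc, LinearIsometryEquiv.norm_map] at hpyth
    have hk := ih (by nlinarith [sq_nonneg (‖A.state (t ++ List.replicate (k + 1) τ) -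
      A.U τ (A.state (t ++ List.replicate k τ))‖)])
    have hstep : ‖A.state (t ++ List.replicate (k + 1) τ) -
        A.U τ (A.state (t ++ List.replicate k τ))‖ ≤ s :=
      le_of_sq_le_sq (by linarith) hs
    rw [Function.iterate_succ_apply']
    refine (norm_sub_le_norm_sub_add_norm_sub _ (A.U τ (A.state (t ++ List.replicate k τ))) _).trans
      ?_
    rw [← map_sub, LinearIsometryEquiv.norm_map]
    push_cast
    linarith

/-- Among the words of the language, take one whose non-halted part is almost as small as
possible. After it the automaton hardly ever halts before the end-mark, so that it behaves like a
measure-once automaton, and a suitable power of `1` leads back close to the same state. -/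
theorem not_acceptsBounded_L0 {m : ℕ} (hm : 0 < m) (A : MM1QFA (Fin 2) Q) :
    ¬ AcceptsBounded A.accProb (L0 m) := by
  rintro ⟨lam, ε, -, -, hε, hacc, hrej⟩
  obtain ⟨k, hk, hU⟩ := exists_iterate_near_id (A.U (some 1)) (half_pos hε)
  have hk0 : (0 : ℝ) < k := Nat.cast_pos.2 (Nat.pos_of_ne_zero hk)
  let s : ℝ := ε / (4 * k)
  have hs : 0 < s := by positivity
  -- The non-halted probabilities over the words of the language.
  let N : Set ℝ := (fun x : List (Fin 2) => ‖A.state (x.map some)‖ ^ 2) '' {x | x ∈ L0 m}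
  have hN : N.Nonempty := by
    obtain ⟨x, hx⟩ := exists_append_mem_L0 hm []
    exact ⟨_, x, hx, rfl⟩
  have hbdd : BddBelow N := ⟨0, by rintro _ ⟨x, -, rfl⟩; positivity⟩
  obtain ⟨_, ⟨x, hx, rfl⟩, hlt⟩ := exists_lt_of_csInf_lt hN (lt_add_of_pos_right (sInf N)
    (by positivity : 0 < s ^ 2))
  have hmap : (x ++ List.replicate k 1).map some =
      x.map some ++ List.replicate k (some (1 : Fin 2)) := by simp
  have hinf : sInf N ≤ ‖A.state ((x ++ List.replicate k 1).map some)‖ ^ 2 := by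
    obtain ⟨u, hu⟩ := exists_append_mem_L0 hm (x ++ List.replicate k 1)
    refine (csInf_le hbdd ⟨_, hu, rfl⟩).trans ?_
    have := A.norm_state_append_le ((x ++ List.replicate k 1).map some) (u.map some)
    rw [← List.map_append] at this
    exact pow_le_pow_left₀ (norm_nonneg _) this 2
  have hdrift := A.norm_state_append_replicate_sub_le (x.map some) (some 1) k hs.le
    (by rw [← hmap]; simp only at hlt; linarith)
  rw [← hmap] at hdrift
  have hnear : ‖A.state ((x ++ List.replicate k 1).map some) - A.state (x.map some)‖ < ε := by
    have h1 := hU (A.state (x.map some))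
    have h2 := mul_le_of_le_one_right (half_pos hε).le (A.norm_state_le_one (x.map some))
    have h3 : k * s = ε / 4 := by
      simp only [s]
      field_simp
    have h4 := norm_sub_le_norm_sub_add_norm_sub
      (A.state ((x ++ List.replicate k 1).map some))
      ((A.U (some 1))^[k] (A.state (x.map some))) (A.state (x.map some))
    linarith
  have hx' := hacc x hx
  have hy := hrej _ (append_ones_notMem_L0 (m := m) hk x)
  rw [accProb_eq] at hx' hy
  rw [List.map_append, accOn_append, ← List.map_append] at hy
  have hend := norm_sq_basisProj_sub_le A.acc
    (φ := A.U none (A.state (x.map some)))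
    (χ := A.U none (A.state ((x ++ List.replicate k 1).map some)))
    (by rw [LinearIsometryEquiv.norm_map]; exact A.norm_state_le_one _)
    (by rw [LinearIsometryEquiv.norm_map]; exact A.norm_state_le_one _)
  rw [← map_sub, LinearIsometryEquiv.norm_map] at hend
  have := A.accOn_nonneg ((List.replicate k (1 : Fin 2)).map some)
    ((x.map some).foldl (fun ψ τ => basisProj A.non (A.U τ ψ)) A.init)
  linarith

end MM1QFA

/-! ### Frequencies with small exponential sums -/

/-- Hoeffding's bound for the exponential moment of a centred function with values in
`[-1, 1]`. -/
theorem sum_exp_mul_le {G : Type*} [Fintype G] {f : G → ℝ} (hf : ∀ g, |f g| ≤ 1)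
    (h0 : ∑ g, f g = 0) (t : ℝ) :
    ∑ g, Real.exp (t * f g) ≤ Fintype.card G * Real.exp (t ^ 2 / 2) := by
  calc ∑ g, Real.exp (t * f g) ≤ ∑ g, (Real.cosh t + f g * Real.sinh t) :=
        Finset.sum_le_sum fun g _ => by
          rw [mul_comm]
          exact Real.exp_mul_le_cosh_add_mul_sinh (hf g) t
    _ = Fintype.card G * Real.cosh t := by
        rw [Finset.sum_add_distrib, ← Finset.sum_mul, h0]
        simp
    _ ≤ _ := by
        gcongr
        exact Real.cosh_le_exp_half_sq t

/-- Chernoff's method with a union bound: if `d` is logarithmic in the number of the centred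
functions `f i`, then some sample of size `d` keeps all their empirical means below `δ`. -/
theorem exists_sample_sum_lt {G ι : Type*} [Fintype G] [Nonempty G] [Fintype ι] {f : ι → G → ℝ}
    (hf : ∀ i g, |f i g| ≤ 1) (h0 : ∀ i, ∑ g, f i g = 0) {δ : ℝ} (hδ : 0 < δ) {d : ℕ}
    (hd : Fintype.card ι < Real.exp (d * δ ^ 2 / 2)) :
    ∃ a : Fin d → G, ∀ i, ∑ j, f i (a j) < d * δ := by
  have hmoment : ∀ i, ∑ a : Fin d → G, Real.exp (δ * ∑ j, f i (a j)) ≤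
      Fintype.card (Fin d → G) * Real.exp (d * δ ^ 2 / 2) := fun i => by
    calc ∑ a : Fin d → G, Real.exp (δ * ∑ j, f i (a j))
        = (∑ g, Real.exp (δ * f i g)) ^ d := by
          simp_rw [Finset.mul_sum, Real.exp_sum, Fintype.sum_pow]
      _ ≤ (Fintype.card G * Real.exp (δ ^ 2 / 2)) ^ d := by
          gcongr
          exact sum_exp_mul_le (hf i) (h0 i) δ
      _ = _ := by
          rw [mul_pow, ← Real.exp_nat_mul, Fintype.card_fun, Fintype.card_fin]
          push_cast
          ring_nf
  have hsum : ∑ a : Fin d → G, ∑ i, Real.exp (δ * ∑ j, f i (a j)) <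
      ∑ _a : Fin d → G, Real.exp (d * δ ^ 2) := by
    rw [Finset.sum_comm]
    refine (Finset.sum_le_sum fun i _ => hmoment i).trans_lt ?_
    have hexp : Real.exp (d * δ ^ 2) =
        Real.exp (d * δ ^ 2 / 2) * Real.exp (d * δ ^ 2 / 2) := by
      rw [← Real.exp_add, add_halves]
    rw [Finset.sum_const, Finset.sum_const, Finset.card_univ, Finset.card_univ, nsmul_eq_mul,
      nsmul_eq_mul, hexp, mul_left_comm]
    gcongr
  obtain ⟨a, -, ha⟩ := Finset.exists_lt_of_sum_lt hsum
  refine ⟨a, fun i => ?_⟩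
  have h := (Finset.single_le_sum (f := fun i => Real.exp (δ * ∑ j, f i (a j)))
    (fun _ _ => (Real.exp_pos _).le) (Finset.mem_univ i)).trans_lt ha
  have h' := Real.exp_lt_exp.1 h
  nlinarith

theorem sum_stdAddChar_mul_eq_zero {m : ℕ} [NeZero m] {j : ZMod m} (hj : j ≠ 0) :
    ∑ g : ZMod m, ZMod.stdAddChar (g * j) = 0 := by
  rw [AddChar.sum_mulShift j (ZMod.isPrimitive_stdAddChar m), if_neg hj, Nat.cast_zero]

/-- A set of `d = O(log m / δ²)` frequencies all of whose nontrivial normalized exponential sums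
modulo `m` are small. -/
theorem exists_frequencies {m : ℕ} [NeZero m] {δ : ℝ} (hδ : 0 < δ) {d : ℕ}
    (hd : 4 * m < Real.exp (d * δ ^ 2 / 2)) :
    ∃ a : Fin d → ZMod m, ∀ j : ZMod m, j ≠ 0 →
      ‖∑ i, ZMod.stdAddChar (a i * j)‖ ^ 2 ≤ 2 * (d * δ) ^ 2 := by
  -- The factors `u k` turn bounds from above for the real part into bounds from both sides for
  -- the real and imaginary parts.
  let u : Fin 4 → ℂ := ![1, -1, Complex.I, -Complex.I]
  have hu : ∀ k, ‖u k‖ = 1 := fun k => by fin_cases k <;> simp [u]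
  let f : {j : ZMod m // j ≠ 0} × Fin 4 → ZMod m → ℝ :=
    fun p g => (u p.2 * ZMod.stdAddChar (g * p.1.1)).re
  have hf : ∀ p g, |f p g| ≤ 1 := fun p g => by
    refine (Complex.abs_re_le_norm _).trans ?_
    rw [norm_mul, hu, one_mul, ZMod.stdAddChar_apply, Circle.norm_coe]
  have h0 : ∀ p, ∑ g, f p g = 0 := fun p => by
    simp only [f]
    rw [← Complex.re_sum, ← Finset.mul_sum, sum_stdAddChar_mul_eq_zero p.1.2, mul_zero,
      Complex.zero_re]
  have hcard : (Fintype.card ({j : ZMod m // j ≠ 0} × Fin 4) : ℝ) ≤ 4 * m := by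
    have h := Fintype.card_subtype_le fun j : ZMod m => j ≠ 0
    rw [ZMod.card] at h
    rw [Fintype.card_prod, Fintype.card_fin, mul_comm]
    exact_mod_cast Nat.mul_le_mul_left 4 h
  obtain ⟨a, ha⟩ := exists_sample_sum_lt hf h0 hδ (hcard.trans_lt hd)
  refine ⟨a, fun j hj => ?_⟩
  have hre : ∀ k, (u k * ∑ i, ZMod.stdAddChar (a i * j)).re < d * δ := fun k => by
    rw [Finset.mul_sum, Complex.re_sum]
    exact ha (⟨j, hj⟩, k)
  generalize ∑ i, ZMod.stdAddChar (a i * j) = z at hre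
  have h1 : z.re < d * δ := by simpa [u] using hre 0
  have h2 : -z.re < d * δ := by simpa [u] using hre 1
  have h3 : -z.im < d * δ := by simpa [u] using hre 2
  have h4 : z.im < d * δ := by simpa [u] using hre 3
  rw [Complex.sq_norm, Complex.normSq_apply]
  nlinarith

/-! ### Automata with classical states -/

/-- Multiplication by a complex number of modulus one, as a unitary operator of `ℂ`. -/
noncomputable def phase (c : Circle) : ℂ ≃ₗᵢ[ℂ] ℂ where
  toLinearEquiv := DistribMulAction.toLinearEquiv ℂ ℂ c
  norm_map' z := by
    change ‖(c : ℂ) * z‖ = ‖z‖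
    rw [norm_mul, Circle.norm_coe, one_mul]

/-- The uniform superposition of `d` basis states. -/
noncomputable def uniformState (d : ℕ) : Hilb (Fin d) :=
  WithLp.toLp 2 fun _ => ((√d : ℝ) : ℂ)⁻¹

theorem norm_uniformState {d : ℕ} (hd : d ≠ 0) : ‖uniformState d‖ = 1 := by
  rw [← sq_eq_sq₀ (norm_nonneg _) zero_le_one, EuclideanSpace.norm_sq_eq]
  simp [uniformState, abs_of_nonneg, hd]

/-- The measurement with accepting projection `P` and rejecting projection `1 - P`. -/
noncomputable def binaryMeasurement {Q : Type*} [Fintype Q] (P : Hilb Q →L[ℂ] Hilb Q)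
    (hP : IsStarProjection P) : ProjMeasurement Bool Q where
  proj γ := if γ then P else 1 - P
  isStarProjection γ := by cases γ <;> simp [hP, hP.one_sub]
  orthogonal γ γ' h := by
    cases γ <;> cases γ' <;> simp_all [hP.mul_one_sub_self, hP.one_sub_mul_self]
  sum_eq_one := by simp

/-- The automaton with frequencies `a`. Its classical state is the last letter read (`1` at the
start). Every letter multiplies the `i`-th amplitude by the root of unity of frequency `a i`. If
the last letter is `0`, the quantum state is measured against the uniform superposition; otherwise
the word is rejected. -/
noncomputable def frequencyQFAC {m : ℕ} [NeZero m] {d : ℕ} (hd : d ≠ 0) (a : Fin d → ZMod m) :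
    QFAC (Fin 2) Bool (Fin 2) (Fin d) where
  start := 1
  init := uniformState d
  norm_init := norm_uniformState hd
  δ _ σ := σ
  U _ _ := LinearIsometryEquiv.piLpCongrRight 2 fun i => phase (ZMod.toCircle (a i))
  meas s := if s = 0 then
      binaryMeasurement (InnerProductSpace.rankOne ℂ (uniformState d) (uniformState d))
        (InnerProductSpace.isStarProjection_rankOne_self (norm_uniformState hd))
    else binaryMeasurement 0 (IsStarProjection.zero _)

section

variable {m : ℕ} [NeZero m] {d : ℕ} (hd : d ≠ 0) (a : Fin d → ZMod m)

theorem frequencyQFAC_config_snd (x : List (Fin 2)) (i : Fin d) :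
    ((frequencyQFAC hd a).config x).2 i =
      ZMod.stdAddChar (a i * (x.length : ZMod m)) * ((√d : ℝ) : ℂ)⁻¹ := by
  induction x using List.reverseRecOn with
  | nil => simp [QFAC.config, frequencyQFAC, uniformState]
  | append_singleton x σ ih =>
    have hstep : ((frequencyQFAC hd a).config (x ++ [σ])).2 i =
        ZMod.stdAddChar (a i) * ((frequencyQFAC hd a).config x).2 i := by
      rw [QFAC.config, List.foldl_append]
      rfl
    rw [hstep, ih, ← mul_assoc, ← AddChar.map_add_eq_mul, List.length_append]
    congr 2
    push_cast
    simp only [List.length_singleton]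
    push_cast
    ring

theorem frequencyQFAC_accProb_append_zero (w : List (Fin 2)) :
    (frequencyQFAC hd a).accProb (w ++ [0]) =
      ‖∑ i, ZMod.stdAddChar (a i * ((w ++ [0]).length : ZMod m))‖ ^ 2 / d ^ 2 := by
  have hs : ((frequencyQFAC hd a).config (w ++ [0])).1 = 0 := by
    rw [QFAC.config, List.foldl_append]
    rfl
  have hinner : inner ℂ (uniformState d) ((frequencyQFAC hd a).config (w ++ [0])).2 =
      (∑ i, ZMod.stdAddChar (a i * ((w ++ [0]).length : ZMod m))) * (d : ℂ)⁻¹ := by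
    have hsq : (((√d : ℝ) : ℂ)⁻¹) * (((√d : ℝ) : ℂ)⁻¹) = (d : ℂ)⁻¹ := by
      rw [← mul_inv, ← Complex.ofReal_mul, Real.mul_self_sqrt (Nat.cast_nonneg d),
        Complex.ofReal_natCast]
    rw [PiLp.inner_apply, Finset.sum_mul]
    refine Finset.sum_congr rfl fun i _ => ?_
    rw [frequencyQFAC_config_snd, ← hsq]
    simp [uniformState, mul_assoc]
  have hmeas : ((frequencyQFAC hd a).meas 0).proj true =
      InnerProductSpace.rankOne ℂ (uniformState d) (uniformState d) := rfl
  rw [QFAC.accProb, QFAC.prob, hs, hmeas, InnerProductSpace.rankOne_apply, hinner, norm_smul,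
    norm_uniformState hd, mul_one, norm_mul, norm_inv, Complex.norm_natCast, mul_pow, inv_pow,
    div_eq_mul_inv]

theorem frequencyQFAC_accProb_nil : (frequencyQFAC hd a).accProb [] = 0 := by
  have hmeas : ((frequencyQFAC hd a).meas 1).proj true = 0 := rfl
  have hs : ((frequencyQFAC hd a).config []).1 = 1 := rfl
  rw [QFAC.accProb, QFAC.prob, hs, hmeas]
  simp

theorem frequencyQFAC_accProb_append_one (w : List (Fin 2)) :
    (frequencyQFAC hd a).accProb (w ++ [1]) = 0 := by
  have hs : ((frequencyQFAC hd a).config (w ++ [1])).1 = 1 := by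
    rw [QFAC.config, List.foldl_append]
    rfl
  have hmeas : ((frequencyQFAC hd a).meas 1).proj true = 0 := rfl
  rw [QFAC.accProb, QFAC.prob, hs, hmeas]
  simp

theorem frequencyQFAC_accProb_of_mem {x : List (Fin 2)} (hx : x ∈ L0 m) :
    (frequencyQFAC hd a).accProb x = 1 := by
  obtain ⟨⟨w, rfl⟩, hdvd⟩ := mem_L0_iff.1 hx
  rw [frequencyQFAC_accProb_append_zero, (ZMod.natCast_eq_zero_iff _ _).2 hdvd]
  simp [hd]

theorem frequencyQFAC_accProb_lt_of_notMem {ε : ℝ} (hε : 0 < ε)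
    (ha : ∀ j : ZMod m, j ≠ 0 → ‖∑ i, ZMod.stdAddChar (a i * j)‖ ^ 2 < ε * d ^ 2)
    {x : List (Fin 2)} (hx : x ∉ L0 m) : (frequencyQFAC hd a).accProb x < ε := by
  rcases List.eq_nil_or_concat' x with rfl | ⟨w, σ, rfl⟩
  · rwa [frequencyQFAC_accProb_nil]
  · fin_cases σ
    · have hd0 : (0 : ℝ) < d ^ 2 := by positivity
      refine (frequencyQFAC_accProb_append_zero hd a w).trans_lt ?_
      rw [div_lt_iff₀ hd0]
      refine ha _ fun h => hx ?_
      exact mem_L0_iff.2 ⟨⟨w, rfl⟩, (ZMod.natCast_eq_zero_iff _ _).1 h⟩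
    · exact (frequencyQFAC_accProb_append_one hd a w).trans_lt hε

end

/-- With the tolerance `δ = √ε / 2`, the number `⌈8 log (4 m) / ε⌉ + 1` of frequencies suffices. -/
theorem exists_small_QFAC {ε : ℝ} (hε : 0 < ε) : ∃ C : ℝ, 0 < C ∧ ∀ m : ℕ, 2 ≤ m →
    ∃ n : ℕ, (n : ℝ) ≤ C * Real.log m ∧ ∃ A : QFAC (Fin 2) Bool (Fin 2) (Fin n),
      (∀ x, x ∈ L0 m → A.accProb x = 1) ∧ (∀ x, x ∉ L0 m → A.accProb x < ε) := by
  refine ⟨24 / ε + 4, by positivity, fun m hm => ?_⟩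
  have : NeZero m := ⟨by omega⟩
  have hm' : (2 : ℝ) ≤ m := by exact_mod_cast hm
  have hlog2 : Real.log 2 ≤ Real.log m := Real.log_le_log (by norm_num) hm'
  have hlog4 : Real.log (4 * m) ≤ 3 * Real.log m := by
    rw [Real.log_mul (by norm_num) (by positivity), show (4 : ℝ) = 2 ^ 2 by norm_num,
      Real.log_pow]
    push_cast
    linarith
  have hlog0 : 0 ≤ Real.log (4 * m) := Real.log_nonneg (by linarith)
  let d : ℕ := ⌈8 * Real.log (4 * m) / ε⌉₊ + 1
  have hd : d ≠ 0 := Nat.succ_ne_zero _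
  have hdlow : 8 * Real.log (4 * m) / ε < d := by
    have := Nat.le_ceil (8 * Real.log (4 * m) / ε)
    simp only [d]
    push_cast
    linarith
  have hdup : (d : ℝ) ≤ (24 / ε + 4) * Real.log m := by
    have h1 := Nat.ceil_lt_add_one (show 0 ≤ 8 * Real.log (4 * m) / ε by positivity)
    have h2 : 8 * Real.log (4 * m) / ε ≤ 24 / ε * Real.log m := by
      rw [div_mul_eq_mul_div]
      exact div_le_div_of_nonneg_right (by linarith) hε.le
    have h3 := Real.log_two_gt_d9
    simp only [d]
    push_cast
    linarith
  have hδsq : (√ε / 2) ^ 2 = ε / 4 := by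
    rw [div_pow, Real.sq_sqrt hε.le]
    norm_num
  have hexp : 4 * (m : ℝ) < Real.exp (d * (√ε / 2) ^ 2 / 2) := by
    rw [← Real.log_lt_iff_lt_exp (by positivity), hδsq]
    rw [div_lt_iff₀ hε] at hdlow
    linarith
  obtain ⟨a, ha⟩ := exists_frequencies (by positivity : 0 < √ε / 2) hexp
  refine ⟨d, hdup, frequencyQFAC hd a, fun x hx => frequencyQFAC_accProb_of_mem hd a hx,
    fun x hx => frequencyQFAC_accProb_lt_of_notMem hd a hε (fun j hj => ?_) hx⟩
  refine (ha j hj).trans_lt ?_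
  have hd0 : (0 : ℝ) < d ^ 2 := by positivity
  rw [mul_pow, hδsq]
  nlinarith

end QFA

theorem mainTheorem2 :
    (∀ m : ℕ, m.Prime →
      (QFA.L0 m).IsRegular ∧
      (∀ (Q : Type*) [Fintype Q] [DecidableEq Q],
        (∀ A : QFA.MO1QFA (Fin 2) Q, ¬ QFA.AcceptsBounded A.accProb (QFA.L0 m)) ∧
        (∀ A : QFA.MM1QFA (Fin 2) Q, ¬ QFA.AcceptsBounded A.accProb (QFA.L0 m))) ∧
      IsLeast (QFA.dfaSizes (QFA.L0 m)) (m + 1)) ∧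
    (∀ ε : ℝ, 0 < ε → ∃ C : ℝ, 0 < C ∧ ∀ m : ℕ, m.Prime →
      ∃ n : ℕ, (n : ℝ) ≤ C * Real.log m ∧
        ∃ A : QFA.QFAC (Fin 2) Bool (Fin 2) (Fin n),
          (∀ x, x ∈ QFA.L0 m → A.accProb x = 1) ∧
          (∀ x, x ∉ QFA.L0 m → A.accProb x < ε)) := by
  refine ⟨fun m hm => ⟨?_, fun Q _ _ => ⟨?_, ?_⟩, ?_⟩, fun ε hε => ?_⟩
  · exact ⟨_, inferInstance, QFA.residueDFA m, QFA.residueDFA_accepts hm.two_le⟩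
  · exact QFA.MO1QFA.not_acceptsBounded_L0 hm.pos
  · exact QFA.MM1QFA.not_acceptsBounded_L0 hm.pos
  · exact QFA.isLeast_dfaSizes_L0 hm.two_le
  · obtain ⟨C, hC, h⟩ := QFA.exists_small_QFAC hε
    exact ⟨C, hC, fun m hm => h m hm.two_le⟩
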